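/- Let $n>k\ge 0$ be integers, let $X$ be a fixed real $n\times k$ matrix of rank $k$, let $\beta\in\mathbb{R}^k$ and $\sigma^2>0$, and let $Y\sim N(X\beta,\sigma^2 I_n)$. Write $$\mathrm{loglik}(b,s\mid Y)=-\tfrac n2\log(2\pi)-\tfrac n2\log s-\tfrac1{2s}(Y-Xb)^T(Y-Xb),\qquad b\in\mathbb{R}^k,\ s>0,$$ for the log-likelihood. For $\beta_0\in\mathbb{R}^k$ and $\sigma_0^2>0$, the likelihood ratio statistic for testing $H_0:(\beta,\sigma^2)=(\beta_0,\sigma_0^2)$ against $H_A:(\beta,\sigma^2)\ne(\beta_0,\sigma_0^2)$ is $$\mathrm{lrt}=-2\Big(\mathrm{loglik}(\beta_0,\sigma_0^2\mid Y)-\sup_{b\in\mathbb{R}^k,\,s>0}\mathrm{loglik}(b,s\mid Y)\Big).$$ Let $\hat\beta=(X^TX)^{-1}X^TY$ and $\hat\sigma^2=\frac1n(Y-X\hat\beta)^T(Y-X\hat\beta)$. For $d\ge1$ let $\chi^2_d$ denote the chi-squared distribution with $d$ degrees of freedom, with density $\frac{2^{-d/2}}{\Gamma(d/2)}x^{d/2-1}e^{-x/2}$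 on $x>0$, and let $\chi^2_0$ be the point mass at $0$. (1) Almost surely $\hat\sigma^2>0$, the supremum is attained at $(\hat\beta,\hat\sigma^2)$, and $$\mathrm{lrt}=-2\big(\mathrm{loglik}(\beta_0,\sigma_0^2\mid Y)-\mathrm{loglik}(\hat\beta,\hat\sigma^2\mid Y)\big)=\frac1{\sigma_0^2}(Y-X\beta_0)^T(Y-X\beta_0)-n\log\frac{\hat\sigma^2}{\sigma_0^2}-n .$$ (2) Suppose that $H_0$ holds, and put $\nu=n-k$, $Q_\nu=n\hat\sigma^2/\sigma_0^2$ and $Q_k=\frac1{\sigma_0^2}\big(X(\hat\beta-\beta_0)\big)^T\big(X(\hat\beta-\beta_0)\big)$. Then $Q_k\sim\chi^2_k$ and $Q_\nu\sim\chi^2_\nu$ are independent, and almost surely $$\mathrm{lrt}=Q_k+\Big\{(Q_\nu-n)-n\log\frac{Q_\nu}{n}\Big\}.$$ Hence $\mathrm{lrt}$ has the law of $Q+\{(Q'-n)-n\log(Q'/n)\}$ for any independent $Q\sim\chi^2_k$ and $Q'\sim\chi^2_\nu$. Equivalently, it is distributed as the sum of two independent random variables, one with law $\chi^2_k$ and the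 other with the log-Lambert W law $\mathrm{LW}(\chi^2_\nu,\theta)$, $\theta=(n(\log n-1),n,1)$, where $\mathrm{LW}(F,(\theta_1,\theta_2,\theta_3))$ is the law of $\theta_1-\theta_2\log Z+\theta_3Z$ for $Z\sim F$. -/

import Mathlib

open MeasureTheory ProbabilityTheory Matrix

noncomputable section

/-- The chi-squared distribution with `d` degrees of freedom: for `d ≥ 1` it has density
`2 ^ (-d / 2) / Γ(d / 2) * x ^ (d / 2 - 1) * exp (-x / 2)` on `x ≥ 0`, and for `d = 0`
it is the point mass at `0`. -/
def chiSquared (d : ℕ) : Measure ℝ :=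
  if d = 0 then Measure.dirac 0 else gammaMeasure ((d : ℝ) / 2) (1 / 2)

/-- The log-Lambert W distribution `LW(F, θ)` with `θ = (θ₁, θ₂, θ₃)`: the law of
`θ₁ - θ₂ log Q + θ₃ Q` where `Q` has law `F`. -/
def logLambertW (F : Measure ℝ) (θ₁ θ₂ θ₃ : ℝ) : Measure ℝ :=
  F.map fun x => θ₁ - θ₂ * Real.log x + θ₃ * x

namespace NormalRegression

variable {n k : ℕ}

/-- The normal distribution `N(Xβ, σ² I)` on `ℝⁿ`; the parameter is `θ = (β, σ²)`. -/
def model (X : Matrix (Fin n) (Fin k) ℝ) (θ : (Fin k → ℝ) × ℝ) :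
    Measure (EuclideanSpace ℝ (Fin n)) :=
  multivariateGaussian (WithLp.toLp 2 (X *ᵥ θ.1)) (θ.2 • (1 : Matrix (Fin n) (Fin n) ℝ))

/-- The parameter space: all `(β, σ²)` with `σ² > 0`. -/
def paramSpace (k : ℕ) : Set ((Fin k → ℝ) × ℝ) := {θ | 0 < θ.2}

/-- `(y - Xβ)ᵀ (y - Xβ)`. -/
def rss (X : Matrix (Fin n) (Fin k) ℝ) (y : EuclideanSpace ℝ (Fin n)) (β : Fin k → ℝ) : ℝ :=
  (y.ofLp - X *ᵥ β) ⬝ᵥ (y.ofLp - X *ᵥ β)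

/-- The log-likelihood of `θ = (β, σ²)` given the observation `y`. -/
def logLik (X : Matrix (Fin n) (Fin k) ℝ) (y : EuclideanSpace ℝ (Fin n))
    (θ : (Fin k → ℝ) × ℝ) : ℝ :=
  -((n : ℝ) / 2) * Real.log (2 * Real.pi) - ((n : ℝ) / 2) * Real.log θ.2
    - 1 / (2 * θ.2) * rss X y θ.1

/-- The likelihood ratio statistic for the simple hypothesis `θ = θ₀` against `θ ≠ θ₀`. -/
def lrt (X : Matrix (Fin n) (Fin k) ℝ) (θ₀ : (Fin k → ℝ) × ℝ)
    (y : EuclideanSpace ℝ (Fin n)) : ℝ :=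
  -2 * (sSup (logLik X y '' {θ₀}) - sSup (logLik X y '' paramSpace k))

/-- The estimator `β̂ = (XᵀX)⁻¹ Xᵀ y`. -/
def betaHat (X : Matrix (Fin n) (Fin k) ℝ) (y : EuclideanSpace ℝ (Fin n)) : Fin k → ℝ :=
  (Xᵀ * X)⁻¹ *ᵥ (Xᵀ *ᵥ y.ofLp)

/-- The estimator `σ̂² = (y - Xβ̂)ᵀ (y - Xβ̂) / n`. -/
def sigmaSqHat (X : Matrix (Fin n) (Fin k) ℝ) (y : EuclideanSpace ℝ (Fin n)) : ℝ :=
  1 / (n : ℝ) * rss X y (betaHat X y)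

/-- `Q_ν = n σ̂² / σ₀²`. -/
def qRes (X : Matrix (Fin n) (Fin k) ℝ) (θ₀ : (Fin k → ℝ) × ℝ)
    (y : EuclideanSpace ℝ (Fin n)) : ℝ :=
  (n : ℝ) * sigmaSqHat X y / θ₀.2

/-- `Q_k = (X(β̂ - β₀))ᵀ (X(β̂ - β₀)) / σ₀²`. -/
def qReg (X : Matrix (Fin n) (Fin k) ℝ) (θ₀ : (Fin k → ℝ) × ℝ)
    (y : EuclideanSpace ℝ (Fin n)) : ℝ :=
  (X *ᵥ (betaHat X y - θ₀.1)) ⬝ᵥ (X *ᵥ (betaHat X y - θ₀.1)) / θ₀.2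

end NormalRegression

end

/-! The vector `X β̂` is the orthogonal projection of `Y` on the column space of `X`. By Pythagoras
the residual sum of squares at `b` is its value at `β̂` plus `‖X(β̂ - b)‖²`, so `β̂` is optimal for
every `s`, and `log x ≤ x - 1` then settles `s`. This gives the closed form wherever `σ̂² > 0`. For
the law, write `Y = Xβ + σz` with `z` standard Gaussian. Under the true parameter `Q_k` and `Q_ν`
are the squared norms of the projections of `z` on the column space and on its orthogonal complement
(`qReg_toLp_add_smul`, `qRes_toLp_add_smul`). These projections are independent standard Gaussians
of dimensions `k` and `n - k`, and `hasLaw_norm_sq_stdGaussian` identifies the laws through moment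
generating functions. Since `n - k > 0`, `Q_ν` is almost surely positive, and so is `σ̂²`. -/

/-- Outside the half line `t < r` the exponential moment of the gamma distribution diverges. -/
lemma mgf_id_gammaMeasure_of_le {a r t : ℝ} (ha : 0 < a) (hr : 0 < r) (ht : r ≤ t) :
    mgf id (gammaMeasure a r) t = 0 := by
  rw [mgf, gammaMeasure, integral_withDensity_eq_integral_toReal_smul (by unfold gammaPDF; fun_prop)
    (by simp [gammaPDF]), integral_undef]
  intro h
  -- No power of `x` is integrable on all of `(0, ∞)`, and for `t ≥ r` the factor `exp ((t - r) x)`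
  -- is at least `1`.
  refine not_integrableOn_Ioi_rpow (a - 1) ?_
  have hc : 0 < r ^ a / Real.Gamma a := by positivity
  refine ((h.integrableOn (s := Set.Ioi 0)).const_mul (r ^ a / Real.Gamma a)⁻¹).mono'
    (by fun_prop) ?_
  filter_upwards [ae_restrict_mem measurableSet_Ioi] with x hx
  have hx : 0 < x := hx
  have hx' : 0 < x ^ (a - 1) := by positivity
  rw [Real.norm_of_nonneg hx'.le, gammaPDF, ENNReal.toReal_ofReal (gammaPDFReal_nonneg ha hr x),
    gammaPDFReal, if_pos hx.le, smul_eq_mul, mul_assoc, mul_assoc, inv_mul_cancel_left₀ hc.ne',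
    ← Real.exp_add]
  refine le_mul_of_one_le_right hx'.le (Real.one_le_exp ?_)
  simp only [id]
  nlinarith

/-- The moment generating function of the gamma distribution. -/
lemma mgf_id_gammaMeasure {a r t : ℝ} (ha : 0 < a) (hr : 0 < r) (ht : t < r) :
    mgf id (gammaMeasure a r) t = (r / (r - t)) ^ a := by
  have hrt : 0 < r - t := sub_pos.2 ht
  have key : ∀ x : ℝ, (gammaPDF a r x).toReal • Real.exp (t * id x) =
      (Set.Ici 0).indicator (fun x => r ^ a / Real.Gamma a *
        (x ^ (a - 1) * Real.exp (-((r - t) * x)))) x := by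
    intro x
    rw [gammaPDF, ENNReal.toReal_ofReal (gammaPDFReal_nonneg ha hr x), gammaPDFReal]
    by_cases hx : 0 ≤ x
    · rw [if_pos hx, Set.indicator_of_mem (by exact hx), smul_eq_mul, mul_assoc, mul_assoc,
        ← Real.exp_add]
      congr 3
      simp only [id]; ring
    · rw [if_neg hx, Set.indicator_of_notMem (by exact hx), zero_smul]
  rw [mgf, gammaMeasure, integral_withDensity_eq_integral_toReal_smul (by unfold gammaPDF; fun_prop)
    (by simp [gammaPDF])]
  simp_rw [key]
  rw [integral_indicator measurableSet_Ici, integral_Ici_eq_integral_Ioi, integral_const_mul,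
    Real.integral_rpow_mul_exp_neg_mul_Ioi ha hrt, Real.div_rpow zero_le_one hrt.le, Real.one_rpow,
    Real.div_rpow hr.le hrt.le]
  have := (Real.Gamma_pos_of_pos ha).ne'
  field_simp

/-- No bound on `t` is needed: for `t ≥ 1 / 2` the integral diverges and both sides take the value
`0` by convention. -/
lemma integral_exp_mul_sq_gaussianReal (t : ℝ) :
    ∫ x, Real.exp (t * x ^ 2) ∂(gaussianReal 0 1) = √((1 / 2) / (1 / 2 - t)) := by
  rw [integral_gaussianReal_eq_integral_smul one_ne_zero]
  have key : ∀ x : ℝ, gaussianPDFReal 0 1 x • Real.exp (t * x ^ 2) =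
      (√(2 * Real.pi))⁻¹ * Real.exp (-(1 / 2 - t) * x ^ 2) := by
    intro x
    rw [gaussianPDFReal, smul_eq_mul, mul_assoc, ← Real.exp_add]
    simp only [NNReal.coe_one, mul_one, sub_zero]
    congr 2
    ring
  simp_rw [key]
  rw [integral_const_mul, integral_gaussian, ← Real.sqrt_inv, ← Real.sqrt_mul (by positivity)]
  congr 1
  have := Real.pi_ne_zero
  field_simp

/-! ### Squared norm of a standard Gaussian vector -/

section NormSq

variable {E : Type*} [NormedAddCommGroup E] [InnerProductSpace ℝ E] [FiniteDimensional ℝ E]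
  [MeasurableSpace E] [BorelSpace E]

/-- Coordinates in an orthonormal basis are independent standard normals, so the exponential moment
factors. -/
lemma mgf_norm_sq_stdGaussian (t : ℝ) :
    mgf (fun x : E => ‖x‖ ^ 2) (stdGaussian E) t =
      √((1 / 2) / (1 / 2 - t)) ^ Module.finrank ℝ E := by
  rw [mgf, stdGaussian_eq_map_pi_orthonormalBasis (stdOrthonormalBasis ℝ E),
    integral_map (Measurable.aemeasurable (by fun_prop)) (by fun_prop),
    ← integral_exp_mul_sq_gaussianReal]
  have key : ∀ x : Fin (Module.finrank ℝ E) → ℝ,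
      Real.exp (t * ‖∑ i, x i • stdOrthonormalBasis ℝ E i‖ ^ 2) =
        ∏ i, Real.exp (t * x i ^ 2) := by
    intro x
    rw [← Real.exp_sum, ← Finset.mul_sum, ← (stdOrthonormalBasis ℝ E).sum_sq_inner_right]
    congr 2
    refine Finset.sum_congr rfl fun i _ => ?_
    rw [(stdOrthonormalBasis ℝ E).orthonormal.inner_right_fintype]
  simp_rw [key]
  rw [integral_fintype_prod_eq_pow (fun x : ℝ => Real.exp (t * x ^ 2)), Fintype.card_fin]

/-- The squared norm of a standard Gaussian vector has a chi-squared distribution. -/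
theorem hasLaw_norm_sq_stdGaussian :
    HasLaw (fun x : E => ‖x‖ ^ 2) (chiSquared (Module.finrank ℝ E)) (stdGaussian E) := by
  refine ⟨by fun_prop, ?_⟩
  by_cases hd : Module.finrank ℝ E = 0
  · have := Module.finrank_zero_iff.1 hd
    have h0 : (fun x : E => ‖x‖ ^ 2) = fun _ => 0 := by
      ext x; simp [Subsingleton.elim x 0]
    rw [chiSquared, if_pos hd, h0, Measure.map_const, measure_univ, one_smul]
  have hdpos : (0 : ℝ) < (Module.finrank ℝ E : ℝ) / 2 := by positivity
  have : IsProbabilityMeasure (gammaMeasure ((Module.finrank ℝ E : ℝ) / 2) (1 / 2)) :=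
    isProbabilityMeasure_gammaMeasure hdpos (by norm_num)
  have : IsProbabilityMeasure ((stdGaussian E).map fun x : E => ‖x‖ ^ 2) :=
    Measure.isProbabilityMeasure_map (by fun_prop)
  rw [chiSquared, if_neg hd]
  have hlt : ∀ t : ℝ, t < 1 / 2 →
      mgf id (gammaMeasure ((Module.finrank ℝ E : ℝ) / 2) (1 / 2)) t =
        √((1 / 2) / (1 / 2 - t)) ^ Module.finrank ℝ E := by
    intro t ht
    have : 0 < 1 / 2 - t := sub_pos.2 ht
    rw [mgf_id_gammaMeasure hdpos (by norm_num) ht, Real.sqrt_eq_rpow, ← Real.rpow_mul_natCast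
      (by positivity)]
    congr 1
    ring
  -- `eqOn_complexMGF_of_mgf` asks for equality at every real `t`, so the conventional values for `t
  -- ≥ 1 / 2` must agree too.
  have hmgf : mgf id (gammaMeasure ((Module.finrank ℝ E : ℝ) / 2) (1 / 2)) =
      mgf id ((stdGaussian E).map fun x : E => ‖x‖ ^ 2) := by
    ext t
    rw [mgf_id_map (by fun_prop), mgf_norm_sq_stdGaussian]
    rcases lt_or_ge t (1 / 2) with ht | ht
    · exact hlt t ht
    · rw [mgf_id_gammaMeasure_of_le hdpos (by norm_num) ht, Real.sqrt_eq_zero_of_nonpos, zero_pow hd]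
      exact div_nonpos_of_nonneg_of_nonpos (by norm_num) (by linarith)
  refine (Measure.ext_of_charFun ?_).symm
  ext t
  -- The characteristic function is the complex mgf on the imaginary axis, which lies in the strip
  -- of analyticity because `0 < 1 / 2`.
  rw [← complexMGF_id_mul_I, ← complexMGF_id_mul_I]
  refine eqOn_complexMGF_of_mgf hmgf ?_
  have hsub : Set.Iio (1 / 2 : ℝ) ⊆
      integrableExpSet id (gammaMeasure ((Module.finrank ℝ E : ℝ) / 2) (1 / 2)) := by
    intro s hs
    -- Without integrability the mgf would be `0` by convention, but its value at `s` is positive.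
    by_contra hn
    have h0 := hlt s hs
    rw [mgf_undef hn] at h0
    have : 0 < 1 / 2 - s := sub_pos.2 hs
    have : 0 < √((1 / 2) / (1 / 2 - s)) ^ Module.finrank ℝ E := by positivity
    exact this.ne h0
  refine interior_mono hsub ?_
  simp [interior_Iio]

end NormSq

/-! ### Projections and affine images of standard Gaussian vectors -/

section Projection

variable {E : Type*} [NormedAddCommGroup E] [InnerProductSpace ℝ E] [FiniteDimensional ℝ E]
  [MeasurableSpace E] [BorelSpace E]

/-- The orthogonal projection of a standard Gaussian vector is a standard Gaussian vector. -/
lemma hasLaw_orthogonalProjectionOnto_stdGaussian (U : Submodule ℝ E) :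
    HasLaw (fun x : E => U.orthogonalProjectionOnto x) (stdGaussian U) (stdGaussian E) := by
  refine ⟨by fun_prop, Measure.ext_of_charFun ?_⟩
  ext t
  -- The adjoint of the projection is the inclusion of `U` in `E`.
  have : charFun ((stdGaussian E).map fun x : E => U.orthogonalProjectionOnto x) t =
      charFun (stdGaussian E) (t : E) := by
    rw [charFun_apply, charFun_apply, integral_map (by fun_prop) (by fun_prop)]
    simp
  rw [this, charFun_stdGaussian, charFun_stdGaussian, Submodule.coe_norm]

/-- The orthogonal projections of a standard Gaussian vector on a subspace and on its orthogonal
complement are independent. -/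
lemma indepFun_orthogonalProjectionOnto_stdGaussian (U : Submodule ℝ E) :
    IndepFun (fun x : E => U.orthogonalProjectionOnto x) (fun x : E => Uᗮ.orthogonalProjectionOnto x)
      (stdGaussian E) := by
  have h : HasGaussianLaw (fun x : E => (U.orthogonalProjectionOnto x, Uᗮ.orthogonalProjectionOnto x))
      (stdGaussian E) := by
    constructor
    exact inferInstanceAs (IsGaussian ((stdGaussian E).map
      (U.orthogonalProjectionOnto.prod Uᗮ.orthogonalProjectionOnto)))
  -- For a jointly Gaussian pair it suffices that the covariances vanish; here they are `⟪u, v⟫`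
  -- with `u ∈ U`, `v ∈ Uᗮ`.
  refine h.indepFun_of_covariance_inner fun u v => ?_
  have h1 : (fun x : E => inner ℝ u (U.orthogonalProjectionOnto x)) = fun x => inner ℝ (u : E) x := by
    ext x; simp
  have h2 : (fun x : E => inner ℝ v (Uᗮ.orthogonalProjectionOnto x)) =
      fun x => inner ℝ (v : E) x := by
    ext x; simp
  rw [h1, h2, ← covarianceBilin_apply_eq_cov IsGaussian.memLp_two_id, covarianceBilin_stdGaussian,
    innerSL_apply_apply]
  exact Submodule.inner_right_of_mem_orthogonal u.2 v.2

end Projection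

lemma multivariateGaussian_smul_one {n : ℕ} (μ : EuclideanSpace ℝ (Fin n)) {s : ℝ} (hs : 0 ≤ s) :
    multivariateGaussian μ (s • (1 : Matrix (Fin n) (Fin n) ℝ)) =
      (stdGaussian (EuclideanSpace ℝ (Fin n))).map fun z => μ + √s • z := by
  refine Measure.ext_of_charFun ?_
  ext t
  have : charFun ((stdGaussian (EuclideanSpace ℝ (Fin n))).map fun z => μ + √s • z) t =
      Complex.exp (inner ℝ t μ * Complex.I) *
        charFun (stdGaussian (EuclideanSpace ℝ (Fin n))) (√s • t) := by
    rw [charFun_apply, charFun_apply, integral_map (by fun_prop) (by fun_prop),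
      ← integral_const_mul]
    congr with z
    rw [← Complex.exp_add, inner_add_left, real_inner_smul_left, real_inner_smul_right,
      real_inner_comm t μ]
    push_cast
    ring_nf
  rw [this, charFun_stdGaussian, charFun_multivariateGaussian (PosSemidef.one.smul hs),
    ← Complex.exp_add, norm_smul, ← Complex.ofReal_pow, mul_pow, Real.norm_of_nonneg (Real.sqrt_nonneg s),
    EuclideanSpace.real_norm_sq_eq]
  congr 1
  rw [sub_eq_add_neg, neg_div]
  congr 2
  have h : ((√s : ℝ) : ℂ) ^ 2 = s := by rw [← Complex.ofReal_pow, Real.sq_sqrt hs]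
  simp only [smul_mulVec, one_mulVec, dotProduct_smul, smul_eq_mul]
  push_cast
  rw [h]
  simp [dotProduct, sq]

/-! ### Least squares and maximum likelihood -/

namespace NormalRegression

variable {n k : ℕ} {X : Matrix (Fin n) (Fin k) ℝ}

lemma isUnit_transpose_mul_self (hX : X.rank = k) : IsUnit (Xᵀ * X) := by
  rw [← Matrix.rank_transpose_mul_self] at hX
  have hrange : LinearMap.range (Xᵀ * X).mulVecLin = ⊤ :=
    Submodule.eq_top_of_finrank_eq (by simpa [Matrix.rank] using hX)
  exact mulVec_surjective_iff_isUnit.1 (LinearMap.range_eq_top.1 hrange)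

/-- The normal equations. -/
lemma transpose_mulVec_residual (hX : X.rank = k) (y : EuclideanSpace ℝ (Fin n)) :
    Xᵀ *ᵥ (y.ofLp - X *ᵥ betaHat X y) = 0 := by
  rw [betaHat, mulVec_sub, mulVec_mulVec, mulVec_mulVec,
    mul_nonsing_inv _ ((isUnit_iff_isUnit_det _).1 (isUnit_transpose_mul_self hX)), one_mulVec,
    sub_self]

lemma residual_dotProduct_mulVec (hX : X.rank = k) (y : EuclideanSpace ℝ (Fin n))
    (b : Fin k → ℝ) : (y.ofLp - X *ᵥ betaHat X y) ⬝ᵥ (X *ᵥ b) = 0 := by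
  rw [dotProduct_mulVec, ← mulVec_transpose, transpose_mulVec_residual hX, zero_dotProduct]

/-- Pythagoras: the cross terms vanish by the normal equations. -/
lemma rss_eq_rss_betaHat_add (hX : X.rank = k) (y : EuclideanSpace ℝ (Fin n)) (b : Fin k → ℝ) :
    rss X y b =
      rss X y (betaHat X y) + (X *ᵥ (betaHat X y - b)) ⬝ᵥ (X *ᵥ (betaHat X y - b)) := by
  have h : y.ofLp - X *ᵥ b = (y.ofLp - X *ᵥ betaHat X y) + X *ᵥ (betaHat X y - b) := by
    rw [mulVec_sub]; abel
  have h0 := residual_dotProduct_mulVec hX y (betaHat X y - b)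
  rw [rss, h, add_dotProduct, dotProduct_add, dotProduct_add, h0,
    dotProduct_comm (X *ᵥ (betaHat X y - b)) (y.ofLp - _), h0, rss]
  ring

lemma rss_betaHat_le (hX : X.rank = k) (y : EuclideanSpace ℝ (Fin n)) (b : Fin k → ℝ) :
    rss X y (betaHat X y) ≤ rss X y b := by
  rw [rss_eq_rss_betaHat_add hX y b]
  exact le_add_of_nonneg_right (by simpa using dotProduct_star_self_nonneg (X *ᵥ (betaHat X y - b)))

lemma rss_betaHat_eq (hn : 0 < n) (y : EuclideanSpace ℝ (Fin n)) :
    rss X y (betaHat X y) = n * sigmaSqHat X y := by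
  have : (n : ℝ) ≠ 0 := by positivity
  rw [sigmaSqHat]
  field_simp

/-- The likelihood is maximal at the least squares estimators. -/
lemma isMaxOn_logLik (hn : 0 < n) (hX : X.rank = k) {y : EuclideanSpace ℝ (Fin n)}
    (hy : 0 < sigmaSqHat X y) :
    IsMaxOn (logLik X y) (paramSpace k) (betaHat X y, sigmaSqHat X y) := by
  rintro ⟨b, s⟩ (hs : 0 < s)
  have hle := rss_betaHat_le hX y b
  rw [rss_betaHat_eq hn] at hle
  -- Optimality in `s` is `log x ≤ x - 1` at `x = σ̂² / s`.
  have hlog := Real.log_le_sub_one_of_pos (div_pos hy hs)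
  rw [Real.log_div hy.ne' hs.ne'] at hlog
  have h1 : 1 / (2 * s) * (n * sigmaSqHat X y) ≤ 1 / (2 * s) * rss X y b := by gcongr
  have h2 : 1 / (2 * sigmaSqHat X y) * (n * sigmaSqHat X y) = n / 2 := by field_simp
  have h3 : 1 / (2 * s) * (n * sigmaSqHat X y) = n / 2 * (sigmaSqHat X y / s) := by field_simp
  have h4 := mul_le_mul_of_nonneg_left hlog (show (0 : ℝ) ≤ n / 2 by positivity)
  simp only [Set.mem_ofPred_eq, logLik, rss_betaHat_eq hn]
  rw [h2]
  rw [h3] at h1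
  linarith

/-- Positivity of `σ̂²` places the maximizer in the parameter space; if `σ̂² = 0`, the likelihood is
unbounded as `s → 0`. -/
lemma lrt_eq_sub (hn : 0 < n) (hX : X.rank = k) (θ₀ : (Fin k → ℝ) × ℝ)
    {y : EuclideanSpace ℝ (Fin n)} (hy : 0 < sigmaSqHat X y) :
    lrt X θ₀ y = -2 * (logLik X y θ₀ - logLik X y (betaHat X y, sigmaSqHat X y)) := by
  have : IsGreatest (logLik X y '' paramSpace k)
      (logLik X y (betaHat X y, sigmaSqHat X y)) := by
    refine ⟨Set.mem_image_of_mem _ hy, ?_⟩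
    rintro _ ⟨θ, hθ, rfl⟩
    exact isMaxOn_logLik hn hX hy hθ
  rw [lrt, Set.image_singleton, csSup_singleton, this.csSup_eq]

lemma lrt_eq (hn : 0 < n) (hX : X.rank = k) (β₀ : Fin k → ℝ) {s₀ : ℝ} (hs₀ : 0 < s₀)
    {y : EuclideanSpace ℝ (Fin n)} (hy : 0 < sigmaSqHat X y) :
    lrt X (β₀, s₀) y =
      1 / s₀ * rss X y β₀ - n * Real.log (sigmaSqHat X y / s₀) - n := by
  have h2 : 1 / (2 * sigmaSqHat X y) * (n * sigmaSqHat X y) = n / 2 := by field_simp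
  rw [lrt_eq_sub hn hX _ hy, Real.log_div hy.ne' hs₀.ne']
  simp only [logLik, rss_betaHat_eq hn]
  rw [h2]
  field_simp
  ring

lemma lrt_eq_qReg_add (hn : 0 < n) (hX : X.rank = k) (β₀ : Fin k → ℝ) {s₀ : ℝ} (hs₀ : 0 < s₀)
    {y : EuclideanSpace ℝ (Fin n)} (hy : 0 < sigmaSqHat X y) :
    lrt X (β₀, s₀) y = qReg X (β₀, s₀) y +
      ((qRes X (β₀, s₀) y - n) - n * Real.log (qRes X (β₀, s₀) y / n)) := by
  have hn' : (n : ℝ) ≠ 0 := by positivity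
  have h : qRes X (β₀, s₀) y / n = sigmaSqHat X y / s₀ := by
    simp only [qRes]; field_simp
  rw [h, lrt_eq hn hX β₀ hs₀ hy, rss_eq_rss_betaHat_add hX, rss_betaHat_eq hn]
  simp only [qReg, qRes]
  ring

/-! ### Geometry of the column space -/

variable (X) in
/-- The column space of the design matrix. -/
def columnSpace : Submodule ℝ (EuclideanSpace ℝ (Fin n)) :=
  LinearMap.range ((WithLp.linearEquiv 2 ℝ (Fin n → ℝ)).symm.toLinearMap ∘ₗ X.mulVecLin)

lemma toLp_mulVec_mem_columnSpace (b : Fin k → ℝ) : WithLp.toLp 2 (X *ᵥ b) ∈ columnSpace X :=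
  ⟨b, rfl⟩

lemma finrank_columnSpace : Module.finrank ℝ (columnSpace X) = X.rank := by
  rw [columnSpace, LinearMap.range_comp, LinearEquiv.finrank_map_eq, Matrix.rank]

lemma starProjection_columnSpace (hX : X.rank = k) (y : EuclideanSpace ℝ (Fin n)) :
    (columnSpace X).starProjection y = WithLp.toLp 2 (X *ᵥ betaHat X y) := by
  refine Submodule.eq_starProjection_of_mem_of_inner_eq_zero (toLp_mulVec_mem_columnSpace _) ?_
  rintro _ ⟨b, rfl⟩
  rw [real_inner_comm]
  simpa [EuclideanSpace.inner_eq_star_dotProduct] using residual_dotProduct_mulVec hX y b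

/-- The projection fixes the mean `Xβ`, which cancels, and the two factors `√s` cancel the division
by `s`. -/
lemma qReg_toLp_add_smul (hX : X.rank = k) (β : Fin k → ℝ) {s : ℝ} (hs : 0 < s)
    (z : EuclideanSpace ℝ (Fin n)) :
    qReg X (β, s) (WithLp.toLp 2 (X *ᵥ β) + √s • z) =
      ‖(columnSpace X).orthogonalProjectionOnto z‖ ^ 2 := by
  have h := starProjection_columnSpace hX (WithLp.toLp 2 (X *ᵥ β) + √s • z)
  rw [map_add, map_smul, Submodule.starProjection_eq_self_iff.2 (toLp_mulVec_mem_columnSpace β)] at h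
  have h' : X *ᵥ (betaHat X (WithLp.toLp 2 (X *ᵥ β) + √s • z) - β) =
      √s • ((columnSpace X).starProjection z).ofLp := by
    rw [mulVec_sub, ← WithLp.ofLp_toLp 2 (X *ᵥ betaHat X _), ← h]
    simp
  rw [qReg, h', Submodule.coe_norm, EuclideanSpace.real_norm_sq_eq, smul_dotProduct,
    dotProduct_smul, smul_smul, Real.mul_self_sqrt hs.le, smul_eq_mul, mul_div_cancel_left₀ _ hs.ne']
  simp [dotProduct, sq]

lemma qRes_toLp_add_smul (hn : 0 < n) (hX : X.rank = k) (β : Fin k → ℝ) {s : ℝ} (hs : 0 < s)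
    (z : EuclideanSpace ℝ (Fin n)) :
    qRes X (β, s) (WithLp.toLp 2 (X *ᵥ β) + √s • z) =
      ‖(columnSpace X)ᗮ.orthogonalProjectionOnto z‖ ^ 2 := by
  have h := starProjection_columnSpace hX (WithLp.toLp 2 (X *ᵥ β) + √s • z)
  rw [map_add, map_smul, Submodule.starProjection_eq_self_iff.2 (toLp_mulVec_mem_columnSpace β)] at h
  have h' : (WithLp.toLp 2 (X *ᵥ β) + √s • z).ofLp -
        X *ᵥ betaHat X (WithLp.toLp 2 (X *ᵥ β) + √s • z) =
      √s • ((columnSpace X)ᗮ.starProjection z).ofLp := by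
    rw [← WithLp.ofLp_toLp 2 (X *ᵥ betaHat X _), ← h, Submodule.starProjection_orthogonal_val]
    simp [smul_sub]
  rw [qRes, ← rss_betaHat_eq hn, rss, h', Submodule.coe_norm, EuclideanSpace.real_norm_sq_eq,
    smul_dotProduct, dotProduct_smul, smul_smul, Real.mul_self_sqrt hs.le, smul_eq_mul,
    mul_div_cancel_left₀ _ hs.ne']
  simp [dotProduct, sq]

lemma continuous_qReg (θ : (Fin k → ℝ) × ℝ) : Continuous (qReg X θ) := by
  unfold qReg betaHat; fun_prop

lemma continuous_qRes (θ : (Fin k → ℝ) × ℝ) : Continuous (qRes X θ) := by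
  unfold qRes sigmaSqHat rss betaHat; fun_prop

/-- Under the true parameter the two quadratic forms are independent chi-squared variables. -/
theorem hasLaw_qReg_qRes (hn : 0 < n) (hX : X.rank = k) (β : Fin k → ℝ) {s : ℝ} (hs : 0 < s) :
    HasLaw (fun y => (qReg X (β, s) y, qRes X (β, s) y))
      ((chiSquared k).prod (chiSquared (n - k))) (model X (β, s)) := by
  have hU : Module.finrank ℝ (columnSpace X) = k := finrank_columnSpace.trans hX
  have hUo : Module.finrank ℝ (columnSpace X)ᗮ = n - k := by
    have := Submodule.finrank_add_finrank_orthogonal (columnSpace X)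
    rw [hU, finrank_euclideanSpace_fin] at this
    omega
  have h1 := hasLaw_norm_sq_stdGaussian.fun_comp
    (hasLaw_orthogonalProjectionOnto_stdGaussian (columnSpace X))
  have h2 := hasLaw_norm_sq_stdGaussian.fun_comp
    (hasLaw_orthogonalProjectionOnto_stdGaussian (columnSpace X)ᗮ)
  rw [hU] at h1
  rw [hUo] at h2
  have h3 := (indepFun_orthogonalProjectionOnto_stdGaussian (columnSpace X)).comp
    (φ := fun u => ‖u‖ ^ 2) (ψ := fun u => ‖u‖ ^ 2) (by fun_prop) (by fun_prop)
  have h4 := (indepFun_iff_hasLaw_prodMk_prod h1 h2).1 h3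
  have hq1 := continuous_qReg (X := X) (β, s)
  have hq2 := continuous_qRes (X := X) (β, s)
  have hm : Measurable fun y => (qReg X (β, s) y, qRes X (β, s) y) :=
    (hq1.prodMk hq2).measurable
  refine ⟨hm.aemeasurable, ?_⟩
  -- Pulled back to the standard Gaussian `z`, the pair becomes the two squared norms of `h4`.
  rw [model, multivariateGaussian_smul_one _ hs.le, Measure.map_map hm (by fun_prop), ← h4.map_eq]
  congr 1
  ext z : 1
  simp only [Function.comp, qReg_toLp_add_smul hX β hs, qRes_toLp_add_smul hn hX β hs]

end NormalRegression

/-! ### Chi-squared laws and the main theorem -/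

lemma isProbabilityMeasure_chiSquared (d : ℕ) : IsProbabilityMeasure (chiSquared d) := by
  rw [chiSquared]
  split_ifs with hd
  · infer_instance
  · exact isProbabilityMeasure_gammaMeasure (by positivity) (by norm_num)

lemma ae_pos_chiSquared {d : ℕ} (hd : d ≠ 0) : ∀ᵐ x ∂chiSquared d, 0 < x := by
  rw [chiSquared, if_neg hd, gammaMeasure, ae_withDensity_iff (by unfold gammaPDF; fun_prop)]
  -- The density vanishes on the negatives but need not vanish at `0`, which is a null set.
  filter_upwards [Measure.ae_ne volume 0] with x hx h
  by_contra hneg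
  exact h (gammaPDF_of_neg (lt_of_le_of_ne (not_lt.1 hneg) hx))

theorem mainTheorem7 {Ω : Type*} [MeasurableSpace Ω] (P : Measure Ω) [IsProbabilityMeasure P]
    (n k : ℕ) (hkn : k < n) (X : Matrix (Fin n) (Fin k) ℝ) (hX : X.rank = k)
    (β : Fin k → ℝ) (σsq : ℝ) (hσ : 0 < σsq)
    (Y : Ω → EuclideanSpace ℝ (Fin n)) (hY : HasLaw Y (NormalRegression.model X (β, σsq)) P)
    (β₀ : Fin k → ℝ) (σ₀sq : ℝ) (hσ₀ : 0 < σ₀sq) :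
    -- for almost every observation the estimators maximize the likelihood,
    -- and the statistic has the closed form
    (∀ᵐ ω ∂P,
      0 < NormalRegression.sigmaSqHat X (Y ω) ∧
      IsMaxOn (NormalRegression.logLik X (Y ω)) (NormalRegression.paramSpace k)
        (NormalRegression.betaHat X (Y ω), NormalRegression.sigmaSqHat X (Y ω)) ∧
      NormalRegression.lrt X (β₀, σ₀sq) (Y ω) =
        -2 * (NormalRegression.logLik X (Y ω) (β₀, σ₀sq) -
          NormalRegression.logLik X (Y ω)
            (NormalRegression.betaHat X (Y ω), NormalRegression.sigmaSqHat X (Y ω))) ∧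
      NormalRegression.lrt X (β₀, σ₀sq) (Y ω) =
        1 / σ₀sq * NormalRegression.rss X (Y ω) β₀
          - n * Real.log (NormalRegression.sigmaSqHat X (Y ω) / σ₀sq) - n) ∧
    -- the null distribution
    ((β, σsq) = (β₀, σ₀sq) →
      HasLaw (fun ω => NormalRegression.qReg X (β₀, σ₀sq) (Y ω)) (chiSquared k) P ∧
      HasLaw (fun ω => NormalRegression.qRes X (β₀, σ₀sq) (Y ω)) (chiSquared (n - k)) P ∧
      IndepFun (fun ω => NormalRegression.qReg X (β₀, σ₀sq) (Y ω))
        (fun ω => NormalRegression.qRes X (β₀, σ₀sq) (Y ω)) P ∧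
      (∀ᵐ ω ∂P, NormalRegression.lrt X (β₀, σ₀sq) (Y ω) =
        NormalRegression.qReg X (β₀, σ₀sq) (Y ω) +
          ((NormalRegression.qRes X (β₀, σ₀sq) (Y ω) - n)
            - n * Real.log (NormalRegression.qRes X (β₀, σ₀sq) (Y ω) / n))) ∧
      HasLaw (fun ω => NormalRegression.lrt X (β₀, σ₀sq) (Y ω))
        (((chiSquared k).prod (chiSquared (n - k))).map
          fun q : ℝ × ℝ => q.1 + ((q.2 - n) - n * Real.log (q.2 / n))) P ∧
      HasLaw (fun ω => NormalRegression.lrt X (β₀, σ₀sq) (Y ω))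
        ((chiSquared k).conv
          (logLambertW (chiSquared (n - k)) (n * (Real.log n - 1)) n 1)) P) := by
  have hn : 0 < n := by omega
  have hd : n - k ≠ 0 := by omega
  have := isProbabilityMeasure_chiSquared k
  have := isProbabilityMeasure_chiSquared (n - k)
  -- The true parameter is used here, since `σ̂² > 0` is needed whether or not the null hypothesis
  -- holds.
  have hjoint := (NormalRegression.hasLaw_qReg_qRes hn hX β hσ).fun_comp hY
  have hRes : HasLaw (fun ω => NormalRegression.qRes X (β, σsq) (Y ω)) (chiSquared (n - k)) P :=
    (measurePreserving_snd (μ := chiSquared k) (ν := chiSquared (n - k))).hasLaw.fun_comp hjoint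
  have hReg : HasLaw (fun ω => NormalRegression.qReg X (β, σsq) (Y ω)) (chiSquared k) P :=
    (measurePreserving_fst (μ := chiSquared k) (ν := chiSquared (n - k))).hasLaw.fun_comp hjoint
  have hpos : ∀ᵐ ω ∂P, 0 < NormalRegression.qRes X (β, σsq) (Y ω) :=
    (hRes.ae_iff (measurableSet_Ioi (a := (0 : ℝ))).mem).2 (ae_pos_chiSquared hd)
  have hsig : ∀ᵐ ω ∂P, 0 < NormalRegression.sigmaSqHat X (Y ω) := by
    filter_upwards [hpos] with ω hω
    have h : (0 : ℝ) < n * NormalRegression.sigmaSqHat X (Y ω) :=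
      (div_pos_iff_of_pos_right hσ).1 hω
    exact (pos_iff_pos_of_mul_pos h).1 (by positivity)
  refine ⟨?_, ?_⟩
  · filter_upwards [hsig] with ω hω
    exact ⟨hω, NormalRegression.isMaxOn_logLik hn hX hω,
      NormalRegression.lrt_eq_sub hn hX _ hω, NormalRegression.lrt_eq hn hX β₀ hσ₀ hω⟩
  intro hθ
  obtain ⟨rfl, rfl⟩ := Prod.mk.inj hθ
  have hindep := (indepFun_iff_hasLaw_prodMk_prod hReg hRes).2 hjoint
  have hlrt : ∀ᵐ ω ∂P, NormalRegression.lrt X (β, σsq) (Y ω) =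
      NormalRegression.qReg X (β, σsq) (Y ω) +
        ((NormalRegression.qRes X (β, σsq) (Y ω) - n)
          - n * Real.log (NormalRegression.qRes X (β, σsq) (Y ω) / n)) := by
    filter_upwards [hsig] with ω hω using NormalRegression.lrt_eq_qReg_add hn hX β hσ hω
  refine ⟨hReg, hRes, hindep, hlrt, ?_, ?_⟩
  · exact HasLaw.congr (HasLaw.fun_comp ⟨by fun_prop, rfl⟩ hjoint) hlrt
  -- For `q > 0`, `(q - n) - n log (q / n) = n (log n - 1) - n log q + q`, which gives the
  -- parameters of the log-Lambert W law.
  · have hm : Measurable fun x : ℝ => n * (Real.log n - 1) - n * Real.log x + 1 * x := by fun_prop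
    have hLW : HasLaw (fun ω => n * (Real.log n - 1) -
        n * Real.log (NormalRegression.qRes X (β, σsq) (Y ω)) +
          1 * NormalRegression.qRes X (β, σsq) (Y ω))
        (logLambertW (chiSquared (n - k)) (n * (Real.log n - 1)) n 1) P :=
      HasLaw.fun_comp ⟨hm.aemeasurable, rfl⟩ hRes
    have := hLW.isProbabilityMeasure_iff.1 inferInstance
    refine ((hindep.comp measurable_id hm).hasLaw_add hReg hLW).congr ?_
    filter_upwards [hlrt, hpos] with ω hω hω'
    rw [hω, Real.log_div hω'.ne' (by positivity)]
    simp only [Pi.add_apply]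
    ring
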